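/- Let $P\subset\mathbb R^d$, $P'\subset\mathbb R^{d'}$ and $Q\subset\mathbb R^{e}$ be lattice polytopes (convex hulls of finitely many points of $\mathbb Z^d$, $\mathbb Z^{d'}$, $\mathbb Z^e$ respectively), and let $\pi:\mathbb R^d\to\mathbb R^e$ and $\pi':\mathbb R^{d'}\to\mathbb R^e$ be affine maps that send lattice points to lattice points and satisfy $\pi(P)=Q=\pi'(P')$. The fiber product is $$P\times_Q P'=\{(p,p')\in P\times P' : \pi(p)=\pi'(p')\}\subset\mathbb R^{d}\times\mathbb R^{d'}.$$ A unimodular triangulation of a polytope is a finite simplicial complex with union the polytope, all of whose maximal simplices are unimodular, i.e. have lattice points as vertices and every lattice point of their affine span is an integral affine combination of the vertices. It is regular if there are real heights $\omega_a$ on the lattice points $a$ of the polytope such that its nonempty faces are exactly the nonempty sets $\operatorname{conv}\{a : \omega_a=\eta(a)\}$, where $\eta$ ranges over the affine functionals with $\eta(a)\le\omega_a$ for all $a$. A minimal non-face is a set of lattice points of the polytope that is not the vertex set of a face, while every proper subset is (the empty set counting as a face). Let $T$ be a unimodular triangulation of $Q$, and let $S$ and $S'$ be unimodular triangulations of $P$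 and $P'$ that refine the pull-back subdivisions $\pi^*T$ and $\pi'^*T$; that is, every simplex of $S$ is contained in $P\cap\pi^{-1}(G)$ for some cell $G$ of $T$, and every simplex of $S'$ is contained in $P'\cap\pi'^{-1}(G)$ for some cell $G$ of $T$. Then $P\times_Q P'$ is a lattice polytope (with respect to $\mathbb Z^d\times\mathbb Z^{d'}$), and it has a unimodular triangulation $U$ such that 1. if $S$ and $S'$ are regular, then $U$ is regular; and 2. every minimal non-face of $U$ either has cardinality $2$ or has the same cardinality as some minimal non-face of $S$ or of $S'$. In particular, for $k\ge 2$, if all minimal non-faces of $S$ and $S'$ have cardinality at most $k$, then so do all minimal non-faces of $U$. -/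

import Mathlib

/-- The lattice `ℤ^d` inside `ℝ^d`: the vectors all of whose coordinates are integers. -/
def intLattice (d : ℕ) : AddSubgroup (Fin d → ℝ) :=
  ((Int.castAddHom ℝ).compLeft (Fin d)).range

section

variable {E E' F : Type*} [AddCommGroup E] [Module ℝ E] [AddCommGroup E'] [Module ℝ E']
  [AddCommGroup F] [Module ℝ F]

/-- A lattice polytope: the convex hull of finitely many lattice points. -/
def IsLatticePolytope (Λ : AddSubgroup E) (P : Set E) : Prop :=
  ∃ V : Finset E, (V : Set E) ⊆ Λ ∧ P = convexHull ℝ (V : Set E)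

/-- The finite set `s` is the vertex set of a unimodular simplex with respect to the lattice `Λ`
(more precisely, with respect to the lattice points in the affine span of `s`): its elements are
affinely independent lattice points, and every lattice point of the affine span of `s` is an
integral affine combination of elements of `s`. Equivalently, some affine isomorphism from `ℝ^k`
onto the affine span of `s` maps `ℤ^k` onto the lattice points of that span and the vertices of
the standard simplex onto `s`. -/
def IsUnimodularSimplex (Λ : AddSubgroup E) (s : Finset E) : Prop :=
  AffineIndependent ℝ ((↑) : s → E) ∧ (s : Set E) ⊆ Λ ∧
    ∀ x ∈ Λ, x ∈ affineSpan ℝ (s : Set E) →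
      ∃ c : E → ℤ, ∑ v ∈ s, c v = 1 ∧ ∑ v ∈ s, c v • v = x

/-- `K` is a unimodular triangulation of `P`: it is a finite simplicial complex that covers exactly
`P`, and all its cells (inclusion-maximal simplices) are unimodular. -/
def IsUnimodularTriangulation (Λ : AddSubgroup E) (K : Geometry.SimplicialComplex ℝ E)
    (P : Set E) : Prop :=
  K.faces.Finite ∧ K.space = P ∧ ∀ s ∈ K.facets, IsUnimodularSimplex Λ s

/-- The faces of the regular subdivision of a polytope `P` that is induced by the heights `ω` on
the lattice points of `P`; a linear functional plus a constant is recorded as one affine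
functional `η`. -/
def regularSubdivision (Λ : AddSubgroup E) (P : Set E) (ω : E → ℝ) : Set (Set E) :=
  {C | ∃ η : E →ᵃ[ℝ] ℝ, (∀ a ∈ P ∩ Λ, η a ≤ ω a) ∧
    C = convexHull ℝ {a | a ∈ P ∩ Λ ∧ ω a = η a}}

/-- A triangulation is regular if its nonempty faces are exactly the nonempty faces of the
regular subdivision induced by some heights on the lattice points. -/
def IsRegularTriangulation (Λ : AddSubgroup E) (K : Geometry.SimplicialComplex ℝ E) : Prop :=
  ∃ ω : E → ℝ, ∀ C : Set E, C.Nonempty →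
    (C ∈ regularSubdivision Λ K.space ω ↔ ∃ s ∈ K.faces, C = convexHull ℝ (s : Set E))

/-- `N` is a minimal non-face of the triangulation `K`: a nonempty finite set of lattice points of
the triangulated polytope that is not (the vertex set of) a face, while each of its nonempty
proper subsets is. (The empty set always counts as a face, but is not listed in `K.faces`.) -/
def IsMinimalNonface (Λ : AddSubgroup E) (K : Geometry.SimplicialComplex ℝ E)
    (N : Finset E) : Prop :=
  N.Nonempty ∧ (N : Set E) ⊆ K.space ∩ Λ ∧ N ∉ K.faces ∧
    ∀ M : Finset E, M ⊂ N → M.Nonempty → M ∈ K.faces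

/-- `π` restricts to a lattice-preserving projection of the polytope `P` onto the polytope `Q`:
it maps lattice points to lattice points, and it maps `P` onto `Q`. -/
def IsLatticeProjection (Λ : AddSubgroup E) (M : AddSubgroup F) (π : E →ᵃ[ℝ] F)
    (P : Set E) (Q : Set F) : Prop :=
  (∀ x ∈ Λ, π x ∈ M) ∧ π '' P = Q

/-- The cells of the pull-back subdivision of `P`: the intersections of `P` with the infinite
prisms `π⁻¹(C)` over the cells `C` of a triangulation of `π(P)`. -/
def pullBackCells (π : E →ᵃ[ℝ] F) (P : Set E) (T : Geometry.SimplicialComplex ℝ F) :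
    Set (Set E) :=
  {C | ∃ t ∈ T.facets, C = P ∩ π ⁻¹' convexHull ℝ (t : Set F)}

/-- The triangulation `K` refines the subdivision with the given cells: every simplex of `K` lies
in one of the cells. -/
def Refines (K : Geometry.SimplicialComplex ℝ E) (cells : Set (Set E)) : Prop :=
  ∀ s ∈ K.faces, ∃ C ∈ cells, convexHull ℝ (s : Set E) ⊆ C

/-- The polyhedral fiber product of `P` and `P'` over `π` and `π'`. -/
def fiberProduct (π : E →ᵃ[ℝ] F) (π' : E' →ᵃ[ℝ] F) (P : Set E) (P' : Set E') : Set (E × E') :=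
  {x | x.1 ∈ P ∧ x.2 ∈ P' ∧ π x.1 = π' x.2}

end

/-!
The triangulation `U` is the staircase triangulation. Order the points of `ℝ^d`, `ℝ^d'` and `ℝ^e`
linearly such that `π` and `π'` are monotone. The faces of `U` are the finite chains in the product
order that consist of points of the fiber product and project to faces of `S` and `S'`.

Let `u` and `v` be the barycentric coordinates of `p` and `p'` with respect to `S` and `S'`. The
coordinates of `(p, p')` with respect to `U` are then a coupling of `u` and `v` that is supported on
a chain. Such a coupling exists (the northwest corner rule). On a chain, the cumulative distribution
function of a coupling is at each point that of `u` or that of `v`, namely the smaller one if the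
weights are nonnegative. Hence the coupling is unique, which makes `U` a simplicial complex, and it
is integral if `u` and `v` are, which makes `U` unimodular. If `π p = π' p'`, then the push-forwards
of `u` and `v` are both the barycentric coordinates of that point with respect to `T`; pushed
forward, the coupling is therefore the diagonal one, so it is supported on the fiber product, and
`U` covers everything.

Being a chain is a condition on pairs, so a minimal non-face with other than two elements fails to
project to a face of `S` or of `S'`, and it projects bijectively to a minimal non-face there.

If `ω` and `ω'` induce `S` and `S'`, then `ω a + ω' a'` induces the subdivision into products of
faces. The supermodular function that counts the lattice points below `(a, a')`, with a small
negative coefficient, refines it to `U`.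
-/

section Weights

open Filter Topology

variable {α β E F : Type*} [AddCommGroup E] [Module ℝ E] [AddCommGroup F] [Module ℝ F]

/-- The total mass of a finitely supported real weight. -/
noncomputable def totalMass : (α →₀ ℝ) →ₗ[ℝ] ℝ := Finsupp.linearCombination ℝ fun _ => 1

/-- The sum `∑ w v • v` for a finitely supported real weight `w` on a vector space; it is the
barycenter of `w` if `w` has total mass one. -/
noncomputable def barycenter : (E →₀ ℝ) →ₗ[ℝ] E := Finsupp.linearCombination ℝ id

/-- The weights of convex combinations: nonnegative and of total mass one. -/
structure IsConvexWeight (w : α →₀ ℝ) : Prop where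
  nonneg : 0 ≤ w
  totalMass_eq_one : totalMass w = 1

theorem linearCombination_eq_sum (g : α → E) {w : α →₀ ℝ} {s : Finset α} (h : w.support ⊆ s) :
    Finsupp.linearCombination ℝ g w = ∑ a ∈ s, w a • g a := by
  rw [Finsupp.linearCombination_apply, Finsupp.sum_of_support_subset _ h]
  simp

theorem totalMass_eq_sum {w : α →₀ ℝ} {s : Finset α} (h : w.support ⊆ s) :
    totalMass w = ∑ a ∈ s, w a := by
  simp [totalMass, linearCombination_eq_sum _ h]

theorem barycenter_eq_sum {w : E →₀ ℝ} {s : Finset E} (h : w.support ⊆ s) :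
    barycenter w = ∑ a ∈ s, w a • a := by
  simp [barycenter, linearCombination_eq_sum _ h]

@[simp]
theorem totalMass_single (a : α) (r : ℝ) : totalMass (Finsupp.single a r) = r := by
  simp [totalMass]

@[simp]
theorem barycenter_single (a : E) (r : ℝ) : barycenter (Finsupp.single a r) = r • a := by
  simp [barycenter]

@[simp]
theorem totalMass_mapDomain (f : α → β) (w : α →₀ ℝ) :
    totalMass (w.mapDomain f) = totalMass w := by
  simp [totalMass, Finsupp.linearCombination_mapDomain, Function.comp_def]

theorem barycenter_mapDomain (f : α → F) (w : α →₀ ℝ) :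
    barycenter (w.mapDomain f) = Finsupp.linearCombination ℝ f w := by
  simp [barycenter, Finsupp.linearCombination_mapDomain]

theorem barycenter_mapDomain_linearMap (f : E →ₗ[ℝ] F) (w : E →₀ ℝ) :
    barycenter (w.mapDomain f) = f (barycenter w) := by
  rw [barycenter_mapDomain, barycenter, Finsupp.apply_linearCombination, Function.comp_id]

theorem barycenter_mapDomain_fst (w : E × F →₀ ℝ) :
    barycenter (w.mapDomain Prod.fst) = (barycenter w).1 :=
  barycenter_mapDomain_linearMap (LinearMap.fst ℝ E F) w

theorem barycenter_mapDomain_snd (w : E × F →₀ ℝ) :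
    barycenter (w.mapDomain Prod.snd) = (barycenter w).2 :=
  barycenter_mapDomain_linearMap (LinearMap.snd ℝ E F) w

theorem linearCombination_affineMap (f : E →ᵃ[ℝ] F) {w : E →₀ ℝ} (hw : totalMass w = 1) :
    Finsupp.linearCombination ℝ f w = f (barycenter w) := by
  rw [totalMass_eq_sum subset_rfl] at hw
  rw [linearCombination_eq_sum _ subset_rfl, barycenter_eq_sum subset_rfl,
    ← Finset.affineCombination_eq_linear_combination _ (fun a : E => a) _ hw,
    Finset.map_affineCombination _ _ _ hw,
    Finset.affineCombination_eq_linear_combination _ _ _ hw]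
  rfl

theorem barycenter_mapDomain_affineMap (f : E →ᵃ[ℝ] F) {w : E →₀ ℝ} (hw : totalMass w = 1) :
    barycenter (w.mapDomain f) = f (barycenter w) := by
  rw [barycenter_mapDomain, linearCombination_affineMap f hw]

theorem support_mapDomain_of_nonneg [DecidableEq β] {w : α →₀ ℝ} (hw : 0 ≤ w) (f : α → β) :
    (w.mapDomain f).support = w.support.image f := by
  refine Finsupp.mapDomain_support.antisymm fun b hb => ?_
  obtain ⟨a, ha, rfl⟩ := Finset.mem_image.1 hb
  have single_le : Finsupp.single a (w a) ≤ w := by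
    classical
    intro c
    rw [Finsupp.single_apply]
    split_ifs with hac
    exacts [hac ▸ le_rfl, hw c]
  have apply_le := Finsupp.mapDomain_mono (f := f) single_le (f a)
  rw [Finsupp.mapDomain_single, Finsupp.single_eq_same] at apply_le
  exact Finsupp.mem_support_iff.2
    (((hw a).lt_of_ne' (Finsupp.mem_support_iff.1 ha)).trans_le apply_le).ne'

theorem eq_zero_of_totalMass_eq_zero {w : α →₀ ℝ} (hw : 0 ≤ w) (h : totalMass w = 0) : w = 0 := by
  rw [totalMass_eq_sum subset_rfl, Finset.sum_eq_zero_iff_of_nonneg fun a _ => hw a] at h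
  ext a
  by_contra ha
  exact ha (h a (Finsupp.mem_support_iff.2 ha))

theorem support_nonempty_of_totalMass_eq_one {w : α →₀ ℝ} (hw : totalMass w = 1) :
    w.support.Nonempty := by
  rw [Finsupp.support_nonempty_iff]
  rintro rfl
  simp at hw

theorem IsConvexWeight.mapDomain {w : α →₀ ℝ} (hw : IsConvexWeight w) (f : α → β) :
    IsConvexWeight (w.mapDomain f) :=
  ⟨Finsupp.mapDomain_nonneg hw.nonneg, (totalMass_mapDomain f w).trans hw.totalMass_eq_one⟩

theorem IsConvexWeight.support_nonempty {w : α →₀ ℝ} (hw : IsConvexWeight w) :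
    w.support.Nonempty :=
  support_nonempty_of_totalMass_eq_one hw.totalMass_eq_one

theorem linearCombination_indicator (g : α → E) (s : Finset α) (c : α → ℝ) :
    Finsupp.linearCombination ℝ g (Finsupp.indicator s fun a _ => c a) = ∑ a ∈ s, c a • g a := by
  rw [linearCombination_eq_sum g (Finsupp.support_indicator_subset s _)]
  exact Finset.sum_congr rfl fun a ha => by rw [Finsupp.indicator_of_mem ha]

theorem isConvexWeight_indicator {s : Finset α} {c : α → ℝ} (hc : ∀ a ∈ s, 0 ≤ c a)
    (hc1 : ∑ a ∈ s, c a = 1) : IsConvexWeight (Finsupp.indicator s fun a _ => c a) where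
  nonneg := fun a => by
    rw [Finsupp.indicator_eq_set_indicator]
    exact Set.indicator_nonneg hc a
  totalMass_eq_one := by simp [totalMass, linearCombination_indicator, hc1]

theorem exists_isConvexWeight_support_eq {s : Finset α} (hs : s.Nonempty) :
    ∃ w : α →₀ ℝ, IsConvexWeight w ∧ w.support = s := by
  have card_pos : 0 < (s.card : ℝ) := by exact_mod_cast hs.card_pos
  refine ⟨Finsupp.indicator s fun _ _ => (s.card : ℝ)⁻¹, isConvexWeight_indicator
    (fun _ _ => by positivity) (by simp [card_pos.ne']), ?_⟩
  classical
  ext a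
  simp [Finsupp.indicator_apply, card_pos.ne']

theorem exists_pos_add_smul_nonneg {u c : α →₀ ℝ} (hu : 0 ≤ u) (hc : c.support ⊆ u.support) :
    ∃ ε : ℝ, 0 < ε ∧ 0 ≤ u + ε • c := by
  have nonneg_at : ∀ a ∈ u.support, ∀ᶠ ε in 𝓝[>] (0 : ℝ), 0 ≤ u a + ε * c a := by
    intro a ha
    have tendsto_apply : Tendsto (fun ε : ℝ => u a + ε * c a) (𝓝[>] 0) (𝓝 (u a)) :=
      tendsto_nhdsWithin_of_tendsto_nhds <|
        Continuous.tendsto' (by fun_prop) _ _ (by simp)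
    exact (tendsto_apply.eventually_const_lt
      ((hu a).lt_of_ne' (Finsupp.mem_support_iff.1 ha))).mono fun _ => le_of_lt
  obtain ⟨ε, hε, h⟩ :=
    (((Finset.eventually_all u.support).2 nonneg_at).and self_mem_nhdsWithin).exists
  refine ⟨ε, h, fun a => ?_⟩
  by_cases ha : a ∈ u.support
  · exact hε a ha
  · simp [Finsupp.notMem_support_iff.1 ha, Finsupp.notMem_support_iff.1 fun h => ha (hc h)]

theorem mem_convexHull_finset_iff {s : Finset E} {x : E} :
    x ∈ convexHull ℝ (s : Set E) ↔
      ∃ w : E →₀ ℝ, IsConvexWeight w ∧ w.support ⊆ s ∧ barycenter w = x := by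
  rw [Finset.mem_convexHull']
  constructor
  · rintro ⟨c, hc, hc1, rfl⟩
    exact ⟨_, isConvexWeight_indicator hc hc1, Finsupp.support_indicator_subset s _,
      linearCombination_indicator id s c⟩
  · rintro ⟨w, hw, hws, rfl⟩
    exact ⟨w, fun a _ => hw.nonneg a, by rw [← totalMass_eq_sum hws, hw.totalMass_eq_one],
      (barycenter_eq_sum hws).symm⟩

theorem mem_affineSpan_finset_iff {s : Finset E} {x : E} :
    x ∈ affineSpan ℝ (s : Set E) ↔
      ∃ w : E →₀ ℝ, w.support ⊆ s ∧ totalMass w = 1 ∧ barycenter w = x := by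
  constructor
  · intro hx
    obtain ⟨t, c, hts, hc, rfl⟩ := eq_affineCombination_of_mem_affineSpan_image
      (p := id) (s := (s : Set E)) (by simpa using hx)
    refine ⟨Finsupp.indicator t fun a _ => c a,
      (Finsupp.support_indicator_subset t _).trans (Finset.coe_subset.1 hts), ?_, ?_⟩
    · simpa [totalMass, linearCombination_indicator] using hc
    · rw [barycenter, linearCombination_indicator,
        Finset.affineCombination_eq_linear_combination _ _ _ hc]
  · rintro ⟨w, hws, hw, rfl⟩
    rw [totalMass_eq_sum hws] at hw
    rw [barycenter_eq_sum hws,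
      ← Finset.affineCombination_eq_linear_combination s (fun a : E => a) w hw]
    simpa using affineCombination_mem_affineSpan_image hw (s' := (s : Set E))
      (fun a ha h => (h ha).elim) (fun a : E => a)

theorem affineIndependent_iff_linearIndependent_prodMk_one {ι : Type*} {p : ι → E} :
    AffineIndependent ℝ p ↔ LinearIndependent ℝ fun i => (p i, (1 : ℝ)) := by
  simp [affineIndependent_iff, linearIndependent_iff', Prod.ext_iff, Prod.fst_sum, Prod.snd_sum,
    imp.swap]

theorem affineIndependent_finset_iff {s : Finset E} :
    AffineIndependent ℝ ((↑) : s → E) ↔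
      ∀ w : E →₀ ℝ, w.support ⊆ s → totalMass w = 0 → barycenter w = 0 → w = 0 := by
  have linearCombination_prodMk_one (w : E →₀ ℝ) :
      Finsupp.linearCombination ℝ (fun a => (a, (1 : ℝ))) w = (barycenter w, totalMass w) := by
    simp [barycenter_eq_sum subset_rfl, totalMass_eq_sum subset_rfl,
      linearCombination_eq_sum _ subset_rfl, Prod.ext_iff, Prod.fst_sum, Prod.snd_sum]
  rw [affineIndependent_iff_linearIndependent_prodMk_one]
  refine (linearIndepOn_iff (v := fun a : E => (a, (1 : ℝ))) (s := (s : Set E))).trans ?_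
  simp only [Finsupp.mem_supported, Finset.coe_subset, linearCombination_prodMk_one,
    Prod.mk_eq_zero, and_imp]
  exact forall₂_congr fun _ _ => imp.swap

theorem eq_of_barycenter_eq_of_affineIndependent {s : Finset E}
    (hs : AffineIndependent ℝ ((↑) : s → E)) {w w' : E →₀ ℝ} (hw : w.support ⊆ s)
    (hw' : w'.support ⊆ s) (ht : totalMass w = totalMass w')
    (hb : barycenter w = barycenter w') : w = w' := by
  classical
  exact sub_eq_zero.1 <| affineIndependent_finset_iff.1 hs _
    (Finsupp.support_sub.trans (Finset.union_subset hw hw')) (by simp [ht]) (by simp [hb])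

theorem exists_affineMap_eqOn_of_affineIndependent {s : Finset E}
    (hs : AffineIndependent ℝ ((↑) : s → E)) (f : E → F) :
    ∃ φ : E →ᵃ[ℝ] F, Set.EqOn φ f s := by
  have h := affineIndependent_iff_linearIndependent_prodMk_one.1 hs
  obtain ⟨ψ, hψ⟩ := ((Module.Basis.span h).constr ℝ fun a : s => f a).exists_extend
  refine ⟨ψ.toAffineMap.comp ((AffineMap.id ℝ E).prod (AffineMap.const ℝ E 1)), fun a ha => ?_⟩
  have := LinearMap.congr_fun hψ (Module.Basis.span h ⟨a, ha⟩)
  rw [Module.Basis.constr_basis, LinearMap.comp_apply, Submodule.subtype_apply,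
    Module.Basis.span_apply] at this
  simpa using this

end Weights

section Couplings

variable {α β γ : Type*}

/-- The mass that a finitely supported real weight puts on a set; for a down-set `Set.Iic x` these
are the values of the cumulative distribution function. -/
noncomputable def massOn (A : Set α) : (α →₀ ℝ) →ₗ[ℝ] ℝ :=
  Finsupp.linearCombination ℝ (A.indicator 1)

theorem massOn_eq_sum_filter (A : Set α) [DecidablePred (· ∈ A)] (w : α →₀ ℝ) :
    massOn A w = ∑ a ∈ w.support with a ∈ A, w a := by
  simp [massOn, linearCombination_eq_sum _ (subset_refl w.support), Set.indicator_apply,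
    Finset.sum_filter]

theorem massOn_mapDomain (f : α → β) (B : Set β) (w : α →₀ ℝ) :
    massOn B (w.mapDomain f) = massOn (f ⁻¹' B) w := by
  rw [massOn, Finsupp.linearCombination_mapDomain]
  rfl

theorem massOn_congr {w : α →₀ ℝ} {A B : Set α} (h : ∀ a ∈ w.support, a ∈ A ↔ a ∈ B) :
    massOn A w = massOn B w := by
  classical
  rw [massOn_eq_sum_filter, massOn_eq_sum_filter, Finset.filter_congr h]

theorem massOn_mono {w : α →₀ ℝ} (hw : 0 ≤ w) {A B : Set α} (h : A ⊆ B) :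
    massOn A w ≤ massOn B w := by
  classical
  rw [massOn_eq_sum_filter, massOn_eq_sum_filter]
  exact Finset.sum_le_sum_of_subset_of_nonneg
    (Finset.monotone_filter_right _ fun _ _ ha => h ha) fun a _ _ => hw a

theorem massOn_mem (H : AddSubgroup ℝ) {w : α →₀ ℝ} (hw : ∀ a, w a ∈ H) (A : Set α) :
    massOn A w ∈ H := by
  classical
  rw [massOn_eq_sum_filter]
  exact H.sum_mem fun a _ => hw a

theorem apply_mem_of_massOn_Iic_mem [PartialOrder α] (H : AddSubgroup ℝ) {w : α →₀ ℝ}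
    (h : ∀ a, massOn (Set.Iic a) w ∈ H) (a : α) : w a ∈ H := by
  classical
  by_contra ha
  have hne : {b ∈ w.support | w b ∉ H}.Nonempty :=
    ⟨a, Finset.mem_filter.2 ⟨Finsupp.mem_support_iff.2 fun h => ha (h ▸ H.zero_mem), ha⟩⟩
  obtain ⟨m, hm⟩ := Finset.exists_minimal hne
  obtain ⟨hms, hmH⟩ := Finset.mem_filter.1 hm.prop
  have below_mem : ∑ b ∈ {b ∈ w.support | b ∈ Set.Iic m}.erase m, w b ∈ H := by
    refine H.sum_mem fun b hb => ?_
    simp only [Finset.mem_erase, Finset.mem_filter, Set.mem_Iic] at hb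
    by_contra hbH
    exact hb.1 (hb.2.2.antisymm (hm.le_of_le (Finset.mem_filter.2 ⟨hb.2.1, hbH⟩) hb.2.2))
  have total_mem := h m
  rw [massOn_eq_sum_filter, ← Finset.add_sum_erase _ _ (a := m) (by simpa using hms)] at total_mem
  exact hmH ((H.add_mem_cancel_right below_mem).1 total_mem)

theorem fst_mem_imp_snd_mem_or_snd_mem_imp_fst_mem [Preorder α] [Preorder β] {N : Set (α × β)}
    (hN : IsChain (· ≤ ·) N) {A : Set α} {B : Set β} (hA : IsLowerSet A) (hB : IsLowerSet B) :
    (∀ x ∈ N, x.1 ∈ A → x.2 ∈ B) ∨ ∀ x ∈ N, x.2 ∈ B → x.1 ∈ A := by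
  by_contra! ⟨⟨x, hx, hxA, hxB⟩, y, hy, hyB, hyA⟩
  rcases hN.total hx hy with hxy | hyx
  · exact hxB (hB hxy.2 hyB)
  · exact hyA (hA hyx.1 hxA)

theorem massOn_Iic_eq_fst_or_snd [Preorder α] [Preorder β] {w : α × β →₀ ℝ}
    (hw : IsChain (· ≤ ·) (w.support : Set (α × β))) (x : α × β) :
    massOn (Set.Iic x) w = massOn (Set.Iic x.1) (w.mapDomain Prod.fst) ∨
      massOn (Set.Iic x) w = massOn (Set.Iic x.2) (w.mapDomain Prod.snd) := by
  simp only [massOn_mapDomain]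
  refine (fst_mem_imp_snd_mem_or_snd_mem_imp_fst_mem hw (isLowerSet_Iic x.1)
    (isLowerSet_Iic x.2)).imp (fun h => ?_) fun h => ?_
  · exact massOn_congr fun y hy => ⟨And.left, fun h1 => ⟨h1, h y hy h1⟩⟩
  · exact massOn_congr fun y hy => ⟨And.right, fun h2 => ⟨h y hy h2, h2⟩⟩

theorem massOn_Iic_eq_min [Preorder α] [Preorder β] {w : α × β →₀ ℝ} (hw : 0 ≤ w)
    (hc : IsChain (· ≤ ·) (w.support : Set (α × β))) (x : α × β) :
    massOn (Set.Iic x) w =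
      min (massOn (Set.Iic x.1) (w.mapDomain Prod.fst))
        (massOn (Set.Iic x.2) (w.mapDomain Prod.snd)) := by
  have le_fst : massOn (Set.Iic x) w ≤ massOn (Set.Iic x.1) (w.mapDomain Prod.fst) := by
    rw [massOn_mapDomain]
    exact massOn_mono hw fun _ => And.left
  have le_snd : massOn (Set.Iic x) w ≤ massOn (Set.Iic x.2) (w.mapDomain Prod.snd) := by
    rw [massOn_mapDomain]
    exact massOn_mono hw fun _ => And.right
  rcases massOn_Iic_eq_fst_or_snd hc x with h | h
  · rw [min_eq_left (h ▸ le_snd), h]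
  · rw [min_eq_right (h ▸ le_fst), h]

theorem apply_mem_of_mapDomain_mem [PartialOrder α] [PartialOrder β] (H : AddSubgroup ℝ)
    {w : α × β →₀ ℝ} (hc : IsChain (· ≤ ·) (w.support : Set (α × β)))
    (h₁ : ∀ a, w.mapDomain Prod.fst a ∈ H) (h₂ : ∀ b, w.mapDomain Prod.snd b ∈ H) (x : α × β) :
    w x ∈ H := by
  refine apply_mem_of_massOn_Iic_mem H (fun y => ?_) x
  rcases massOn_Iic_eq_fst_or_snd hc y with h | h
  · exact h ▸ massOn_mem H h₁ _
  · exact h ▸ massOn_mem H h₂ _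

/-- `w` couples `u` and `v` monotonically: its marginals are `u` and `v`, and its support is a
chain in the product order. -/
structure IsMonotoneCoupling [Preorder α] [Preorder β] (u : α →₀ ℝ) (v : β →₀ ℝ)
    (w : α × β →₀ ℝ) : Prop where
  nonneg : 0 ≤ w
  mapDomain_fst : w.mapDomain Prod.fst = u
  mapDomain_snd : w.mapDomain Prod.snd = v
  isChain_support : IsChain (· ≤ ·) (w.support : Set (α × β))

namespace IsMonotoneCoupling

theorem unique [PartialOrder α] [PartialOrder β] {u : α →₀ ℝ} {v : β →₀ ℝ} {w w' : α × β →₀ ℝ}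
    (h : IsMonotoneCoupling u v w) (h' : IsMonotoneCoupling u v w') : w = w' := by
  ext x
  rw [← sub_eq_zero, ← Finsupp.sub_apply, ← AddSubgroup.mem_bot]
  refine apply_mem_of_massOn_Iic_mem _ (fun y => ?_) x
  rw [AddSubgroup.mem_bot, map_sub, massOn_Iic_eq_min h.nonneg h.isChain_support,
    massOn_Iic_eq_min h'.nonneg h'.isChain_support, h.mapDomain_fst, h.mapDomain_snd,
    h'.mapDomain_fst, h'.mapDomain_snd, sub_self]

section Preorder

variable [Preorder α] [Preorder β] {u : α →₀ ℝ} {v : β →₀ ℝ} {w : α × β →₀ ℝ}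

theorem image_fst_support [DecidableEq α] (h : IsMonotoneCoupling u v w) :
    w.support.image Prod.fst = u.support := by
  rw [← support_mapDomain_of_nonneg h.nonneg, h.mapDomain_fst]

theorem image_snd_support [DecidableEq β] (h : IsMonotoneCoupling u v w) :
    w.support.image Prod.snd = v.support := by
  rw [← support_mapDomain_of_nonneg h.nonneg, h.mapDomain_snd]

theorem add_single (h : IsMonotoneCoupling u v w) {a : α} {b : β} {m : ℝ} (hm : 0 ≤ m)
    (ha : ∀ x ∈ u.support, x ≤ a) (hb : ∀ y ∈ v.support, y ≤ b) :
    IsMonotoneCoupling (u + Finsupp.single a m) (v + Finsupp.single b m)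
      (w + Finsupp.single (a, b) m) where
  nonneg := add_nonneg h.nonneg (Finsupp.single_nonneg.2 hm)
  mapDomain_fst := by rw [Finsupp.mapDomain_add, h.mapDomain_fst, Finsupp.mapDomain_single]
  mapDomain_snd := by rw [Finsupp.mapDomain_add, h.mapDomain_snd, Finsupp.mapDomain_single]
  isChain_support := by
    classical
    have support_le : ∀ x ∈ w.support, x ≤ (a, b) := fun x hx =>
      ⟨ha _ (h.image_fst_support ▸ Finset.mem_image_of_mem _ hx),
        hb _ (h.image_snd_support ▸ Finset.mem_image_of_mem _ hx)⟩
    refine (h.isChain_support.insert fun x hx _ => Or.inr (support_le x hx)).mono fun x hx => ?_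
    rcases Finset.mem_union.1 (Finsupp.support_add hx) with hx | hx
    · exact Or.inr hx
    · exact Or.inl (Finset.mem_singleton.1 (Finsupp.support_single_subset hx))

theorem map {α' β' : Type*} [Preorder α'] [Preorder β'] (h : IsMonotoneCoupling u v w)
    {f : α → α'} {g : β → β'} (hf : Monotone f) (hg : Monotone g) :
    IsMonotoneCoupling (u.mapDomain f) (v.mapDomain g) (w.mapDomain (Prod.map f g)) where
  nonneg := Finsupp.mapDomain_nonneg h.nonneg
  mapDomain_fst := by
    rw [← h.mapDomain_fst, ← Finsupp.mapDomain_comp, ← Finsupp.mapDomain_comp]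
    rfl
  mapDomain_snd := by
    rw [← h.mapDomain_snd, ← Finsupp.mapDomain_comp, ← Finsupp.mapDomain_comp]
    rfl
  isChain_support := by
    classical
    refine IsChain.mono (Finset.coe_subset.2 Finsupp.mapDomain_support) ?_
    rw [Finset.coe_image]
    exact (hf.prodMap hg).isChain_image h.isChain_support

end Preorder

theorem diagonal [LinearOrder α] {u : α →₀ ℝ} (hu : 0 ≤ u) :
    IsMonotoneCoupling u u (u.mapDomain fun a => (a, a)) where
  nonneg := Finsupp.mapDomain_nonneg hu
  mapDomain_fst := by rw [← Finsupp.mapDomain_comp]; exact Finsupp.mapDomain_id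
  mapDomain_snd := by rw [← Finsupp.mapDomain_comp]; exact Finsupp.mapDomain_id
  isChain_support := by
    refine IsChain.mono (Finset.coe_subset.2 Finsupp.mapDomain_support) ?_
    rw [Finset.coe_image]
    exact (monotone_id.prodMk monotone_id).isChain_image (isChain_of_trichotomous _)

theorem map_fst_eq_map_snd [Preorder α] [Preorder β] [LinearOrder γ] {u : α →₀ ℝ}
    {v : β →₀ ℝ} {w : α × β →₀ ℝ} (h : IsMonotoneCoupling u v w) {f : α → γ} {g : β → γ}
    (hf : Monotone f) (hg : Monotone g) (huv : u.mapDomain f = v.mapDomain g) {x : α × β}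
    (hx : x ∈ w.support) : f x.1 = g x.2 := by
  have eq_diagonal := (huv ▸ h.map hf hg).unique
    (diagonal (h.mapDomain_snd ▸ Finsupp.mapDomain_nonneg (Finsupp.mapDomain_nonneg h.nonneg)))
  have hx' : Prod.map f g x ∈ (w.mapDomain (Prod.map f g)).support := by
    rw [support_mapDomain_of_nonneg h.nonneg]
    exact Finset.mem_image_of_mem _ hx
  rw [eq_diagonal] at hx'
  obtain ⟨c, -, hc⟩ := Finset.mem_image.1 (Finsupp.mapDomain_support hx')
  rw [Prod.ext_iff] at hc
  exact hc.1.symm.trans hc.2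

end IsMonotoneCoupling

theorem sub_single_nonneg {u : α →₀ ℝ} (hu : 0 ≤ u) {a : α} {m : ℝ} (hm : m ≤ u a) :
    0 ≤ u - Finsupp.single a m := by
  classical
  intro b
  rcases eq_or_ne a b with rfl | hab
  · simpa using hm
  · simpa [Finsupp.single_apply, hab] using hu b

theorem support_sub_single_subset {u : α →₀ ℝ} {a : α} (ha : a ∈ u.support) (m : ℝ) :
    (u - Finsupp.single a m).support ⊆ u.support := by
  classical
  exact Finsupp.support_sub.trans (Finset.union_subset subset_rfl
    (Finsupp.support_single_subset.trans (Finset.singleton_subset_iff.2 ha)))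

theorem support_sub_single_self_ssubset {u : α →₀ ℝ} {a : α} (ha : a ∈ u.support) :
    (u - Finsupp.single a (u a)).support ⊂ u.support := by
  classical
  rw [← Finsupp.erase_eq_sub_single, Finsupp.support_erase]
  exact Finset.erase_ssubset ha

theorem exists_isMonotoneCoupling [LinearOrder α] [LinearOrder β] {u : α →₀ ℝ} {v : β →₀ ℝ}
    (hu : 0 ≤ u) (hv : 0 ≤ v) (huv : totalMass u = totalMass v) :
    ∃ w : α × β →₀ ℝ, IsMonotoneCoupling u v w := by
  induction hn : u.support.card + v.support.card using Nat.strong_induction_on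
    generalizing u v with
  | _ n ih =>
  rcases eq_or_ne u 0 with rfl | hu0
  · obtain rfl : v = 0 := eq_zero_of_totalMass_eq_zero hv (by simpa using huv.symm)
    exact ⟨0, le_rfl, by simp, by simp, by simp⟩
  have hv0 : v ≠ 0 := by
    rintro rfl
    exact hu0 (eq_zero_of_totalMass_eq_zero hu (by simpa using huv))
  obtain ⟨a, ha, le_a⟩ := Finset.exists_max_image _ id (Finsupp.support_nonempty_iff.2 hu0)
  obtain ⟨b, hb, le_b⟩ := Finset.exists_max_image _ id (Finsupp.support_nonempty_iff.2 hv0)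
  -- Couple as much mass as possible of the two largest points, and recurse on the rest.
  let m := min (u a) (v b)
  have hsu := support_sub_single_subset ha m
  have hsv := support_sub_single_subset hb m
  have card_lt :
      (u - Finsupp.single a m).support.card + (v - Finsupp.single b m).support.card < n := by
    rw [← hn]
    rcases min_choice (u a) (v b) with h | h
    · exact add_lt_add_of_lt_of_le
        (Finset.card_lt_card (by simpa only [m, h] using support_sub_single_self_ssubset ha))
        (Finset.card_le_card hsv)
    · exact add_lt_add_of_le_of_lt (Finset.card_le_card hsu)
        (Finset.card_lt_card (by simpa only [m, h] using support_sub_single_self_ssubset hb))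
  obtain ⟨w, hw⟩ := ih _ card_lt (sub_single_nonneg hu (min_le_left _ _))
    (sub_single_nonneg hv (min_le_right _ _)) (by simp [huv]) rfl
  refine ⟨w + Finsupp.single (a, b) m, ?_⟩
  simpa using hw.add_single (le_min (hu a) (hv b)) (fun x hx => le_a x (hsu hx))
    (fun y hy => le_b y (hsv hy))

end Couplings

section Complexes

open Geometry

variable {E : Type*} [AddCommGroup E] [Module ℝ E]

theorem convexWeight_unique_of_support_mem_faces (K : SimplicialComplex ℝ E) {w w' : E →₀ ℝ}
    (hw : IsConvexWeight w) (hw' : IsConvexWeight w') (hs : w.support ∈ K.faces)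
    (hs' : w'.support ∈ K.faces) (hb : barycenter w = barycenter w') : w = w' := by
  classical
  have mem_inter : barycenter w ∈ convexHull ℝ (w.support ∩ w'.support : Set E) :=
    K.inter_subset_convexHull hs hs'
      ⟨mem_convexHull_finset_iff.2 ⟨w, hw, subset_rfl, rfl⟩,
        mem_convexHull_finset_iff.2 ⟨w', hw', subset_rfl, hb.symm⟩⟩
  rw [← Finset.coe_inter] at mem_inter
  obtain ⟨u, hu, hus, hub⟩ := mem_convexHull_finset_iff.1 mem_inter
  rw [Finset.subset_inter_iff] at hus
  calc
    w = u := eq_of_barycenter_eq_of_affineIndependent (K.indep hs) subset_rfl hus.1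
      (hw.totalMass_eq_one.trans hu.totalMass_eq_one.symm) hub.symm
    _ = w' := eq_of_barycenter_eq_of_affineIndependent (K.indep hs') hus.2 subset_rfl
      (hu.totalMass_eq_one.trans hw'.totalMass_eq_one.symm) (hub.trans hb)

theorem mem_space_iff_exists_convexWeight {K : SimplicialComplex ℝ E} {x : E} :
    x ∈ K.space ↔ ∃ w : E →₀ ℝ, IsConvexWeight w ∧ w.support ∈ K.faces ∧ barycenter w = x := by
  rw [SimplicialComplex.mem_space_iff]
  constructor
  · rintro ⟨s, hs, hxs⟩
    obtain ⟨w, hw, hws, hb⟩ := mem_convexHull_finset_iff.1 hxs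
    exact ⟨w, hw, K.down_closed hs hws hw.support_nonempty, hb⟩
  · rintro ⟨w, hw, hws, hb⟩
    exact ⟨w.support, hws, mem_convexHull_finset_iff.2 ⟨w, hw, subset_rfl, hb⟩⟩

section WeightUnique

variable {faces : Set (Finset E)} (hfaces : IsRelLowerSet faces Finset.Nonempty)
  (hinj : Set.InjOn barycenter {w : E →₀ ℝ | IsConvexWeight w ∧ w.support ∈ faces})

include hfaces hinj

theorem affineIndependent_of_injOn_barycenter {s : Finset E} (hs : s ∈ faces) :
    AffineIndependent ℝ ((↑) : s → E) := by
  classical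
  rw [affineIndependent_finset_iff]
  intro c hcs hc hb
  obtain ⟨u, hu, rfl⟩ := exists_isConvexWeight_support_eq (hfaces hs).1
  obtain ⟨ε, hε, nonneg⟩ := exists_pos_add_smul_nonneg hu.nonneg hcs
  have hw : IsConvexWeight (u + ε • c) := ⟨nonneg, by simp [hu.totalMass_eq_one, hc]⟩
  have support_subset : (u + ε • c).support ⊆ u.support :=
    Finsupp.support_add.trans (Finset.union_subset subset_rfl (Finsupp.support_smul.trans hcs))
  have perturb_eq : u + ε • c = u :=
    hinj ⟨hw, (hfaces hs).2 support_subset hw.support_nonempty⟩ ⟨hu, hs⟩ (by simp [hb])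
  simpa [hε.ne'] using perturb_eq

theorem convexHull_inter_subset_of_injOn_barycenter {s t : Finset E} (hs : s ∈ faces)
    (ht : t ∈ faces) :
    convexHull ℝ s ∩ convexHull ℝ t ⊆ convexHull ℝ (s ∩ t : Set E) := by
  classical
  rintro x ⟨hxs, hxt⟩
  obtain ⟨u, hu, hus, hub⟩ := mem_convexHull_finset_iff.1 hxs
  obtain ⟨v, hv, hvt, hvb⟩ := mem_convexHull_finset_iff.1 hxt
  have weights_eq : u = v := hinj ⟨hu, (hfaces hs).2 hus hu.support_nonempty⟩
    ⟨hv, (hfaces ht).2 hvt hv.support_nonempty⟩ (hub.trans hvb.symm)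
  rw [← Finset.coe_inter]
  exact mem_convexHull_finset_iff.2 ⟨u, hu, Finset.subset_inter hus (weights_eq ▸ hvt), hub⟩

end WeightUnique

/-- The simplicial complex with a given downward closed family of faces, provided that every point
is the barycenter of at most one convex weight supported on a face. -/
def simplicialComplexOfInjOnBarycenter (faces : Set (Finset E))
    (hfaces : IsRelLowerSet faces Finset.Nonempty)
    (hinj : Set.InjOn barycenter {w : E →₀ ℝ | IsConvexWeight w ∧ w.support ∈ faces}) :
    SimplicialComplex ℝ E where
  faces := faces
  isRelLowerSet_faces := hfaces
  indep := affineIndependent_of_injOn_barycenter hfaces hinj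
  inter_subset_convexHull := convexHull_inter_subset_of_injOn_barycenter hfaces hinj

theorem exists_facet_superset {K : SimplicialComplex ℝ E} (hK : K.faces.Finite) {s : Finset E}
    (hs : s ∈ K.faces) : ∃ t ∈ K.facets, s ⊆ t := by
  obtain ⟨t, hst, ht⟩ := hK.exists_le_maximal hs
  exact ⟨t, ⟨ht.prop, fun u hu htu => htu.antisymm (ht.le_of_ge hu htu)⟩, hst⟩

end Complexes

section Unimodular

open Geometry

variable {E : Type*} [AddCommGroup E] [Module ℝ E] {Λ : AddSubgroup E} {s t : Finset E}
  {K : SimplicialComplex ℝ E} {P : Set E}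

theorem IsUnimodularSimplex.apply_mem_range_intCast (hs : IsUnimodularSimplex Λ s) {w : E →₀ ℝ}
    (hws : w.support ⊆ s) (hw : totalMass w = 1) (hb : barycenter w ∈ Λ) (a : E) :
    w a ∈ (Int.castAddHom ℝ).range := by
  obtain ⟨c, hc, hcb⟩ := hs.2.2 _ hb (mem_affineSpan_finset_iff.2 ⟨w, hws, hw, rfl⟩)
  have weight_eq : w = Finsupp.indicator s fun a _ => (c a : ℝ) := by
    refine eq_of_barycenter_eq_of_affineIndependent hs.1 hws
      (Finsupp.support_indicator_subset s _) ?_ ?_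
    · rw [hw, totalMass, linearCombination_indicator]
      simpa using mod_cast hc.symm
    · rw [← hcb, barycenter, linearCombination_indicator]
      simp [Int.cast_smul_eq_zsmul]
  rw [weight_eq, Finsupp.indicator_eq_set_indicator]
  by_cases ha : a ∈ (s : Set E)
  · exact ⟨c a, by simp [ha]⟩
  · exact ⟨0, by simp [ha]⟩

theorem isUnimodularSimplex_of_apply_mem_range_intCast (hs : AffineIndependent ℝ ((↑) : s → E))
    (hsΛ : (s : Set E) ⊆ Λ)
    (h : ∀ w : E →₀ ℝ, w.support ⊆ s → totalMass w = 1 → barycenter w ∈ Λ →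
      ∀ a, w a ∈ (Int.castAddHom ℝ).range) :
    IsUnimodularSimplex Λ s := by
  refine ⟨hs, hsΛ, fun x hxΛ hx => ?_⟩
  obtain ⟨w, hws, hw, rfl⟩ := mem_affineSpan_finset_iff.1 hx
  choose c hc using h w hws hw hxΛ
  refine ⟨c, ?_, ?_⟩
  · rw [totalMass_eq_sum hws] at hw
    simp_rw [← hc, Int.coe_castAddHom] at hw
    exact_mod_cast hw
  · rw [barycenter_eq_sum hws]
    simp [← hc, Int.cast_smul_eq_zsmul]

theorem IsUnimodularSimplex.mono (hs : IsUnimodularSimplex Λ s) (hts : t ⊆ s) :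
    IsUnimodularSimplex Λ t :=
  isUnimodularSimplex_of_apply_mem_range_intCast (hs.1.mono (Finset.coe_subset.2 hts))
    ((Finset.coe_subset.2 hts).trans hs.2.1)
    fun _ hwt => hs.apply_mem_range_intCast (hwt.trans hts)

theorem IsUnimodularSimplex.mem_of_mem_convexHull (hs : IsUnimodularSimplex Λ s) {x : E}
    (hxΛ : x ∈ Λ) (hx : x ∈ convexHull ℝ (s : Set E)) : x ∈ s := by
  obtain ⟨w, hw, hws, rfl⟩ := mem_convexHull_finset_iff.1 hx
  obtain ⟨a, ha⟩ := hw.support_nonempty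
  obtain ⟨n, hn⟩ := hs.apply_mem_range_intCast hws hw.totalMass_eq_one hxΛ a
  have one_le : 1 ≤ w a := by
    have : 0 < w a := (hw.nonneg a).lt_of_ne' (Finsupp.mem_support_iff.1 ha)
    rw [← hn] at this ⊢
    simp only [Int.coe_castAddHom] at this ⊢
    exact_mod_cast this
  have rest_eq_zero : w - Finsupp.single a 1 = 0 := eq_zero_of_totalMass_eq_zero
    (sub_single_nonneg hw.nonneg one_le) (by simp [hw.totalMass_eq_one])
  simpa [sub_eq_zero.1 rest_eq_zero] using hws ha

theorem IsUnimodularTriangulation.isUnimodularSimplex (hK : IsUnimodularTriangulation Λ K P)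
    (hs : s ∈ K.faces) : IsUnimodularSimplex Λ s := by
  obtain ⟨t, ht, hst⟩ := exists_facet_superset hK.1 hs
  exact (hK.2.2 t ht).mono hst

theorem IsUnimodularTriangulation.singleton_mem_faces (hK : IsUnimodularTriangulation Λ K P)
    {x : E} (hx : x ∈ K.space ∩ Λ) : {x} ∈ K.faces := by
  obtain ⟨s, hs, hxs⟩ := SimplicialComplex.mem_space_iff.1 hx.1
  exact K.down_closed hs (Finset.singleton_subset_iff.2
    ((hK.isUnimodularSimplex hs).mem_of_mem_convexHull hx.2 hxs)) (Finset.singleton_nonempty x)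

theorem IsUnimodularTriangulation.coe_subset_space_inter (hK : IsUnimodularTriangulation Λ K P)
    (hs : s ∈ K.faces) : (s : Set E) ⊆ K.space ∩ Λ :=
  Set.subset_inter (K.subset_space hs) (hK.isUnimodularSimplex hs).2.1

theorem IsUnimodularTriangulation.finite_space_inter (hK : IsUnimodularTriangulation Λ K P) :
    (K.space ∩ Λ).Finite :=
  (hK.1.preimage Finset.singleton_injective.injOn).subset fun _ => hK.singleton_mem_faces

theorem IsUnimodularTriangulation.isLatticePolytope (hK : IsUnimodularTriangulation Λ K P)
    (hP : Convex ℝ P) : IsLatticePolytope Λ P := by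
  have hfin := hK.finite_space_inter
  refine ⟨hfin.toFinset, by simp, ?_⟩
  rw [Set.Finite.coe_toFinset, ← hK.2.1]
  refine Set.Subset.antisymm (fun x hx => ?_) (convexHull_min Set.inter_subset_left (hK.2.1 ▸ hP))
  obtain ⟨s, hs, hxs⟩ := SimplicialComplex.mem_space_iff.1 hx
  exact convexHull_mono (hK.coe_subset_space_inter hs) hxs

theorem IsLatticePolytope.convex (hP : IsLatticePolytope Λ P) : Convex ℝ P := by
  obtain ⟨V, -, rfl⟩ := hP
  exact convex_convexHull ℝ _

end Unimodular

section Regularity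

open Geometry Filter Topology

variable {α β : Type*}

/-- `η` supports the heights `ω` from below on `A`, and touches them exactly at the points of `s`.
In the language of regular subdivisions, `s` spans the face that `η` cuts out. -/
structure IsLowerSupport (A : Set α) (ω η : α → ℝ) (s : Set α) : Prop where
  le : ∀ a ∈ A, η a ≤ ω a
  eq_iff : ∀ a ∈ A, ω a = η a ↔ a ∈ s

namespace IsLowerSupport

variable {A B s t : Set α} {ω η θ ζ : α → ℝ}

theorem mono (h : IsLowerSupport A ω η s) (hBA : B ⊆ A) : IsLowerSupport B ω η s :=
  ⟨fun a ha => h.le a (hBA ha), fun a ha => h.eq_iff a (hBA ha)⟩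

theorem congr (h : IsLowerSupport A ω η s) (hη : ∀ a ∈ A, η a = ζ a)
    (hs : ∀ a ∈ A, a ∈ s ↔ a ∈ t) : IsLowerSupport A ω ζ t :=
  ⟨fun a ha => hη a ha ▸ h.le a ha, fun a ha => by rw [← hη a ha, h.eq_iff a ha, hs a ha]⟩

theorem setOf_eq (h : IsLowerSupport A ω η s) (hs : s ⊆ A) : {a | a ∈ A ∧ ω a = η a} = s := by
  ext a
  exact ⟨fun ha => (h.eq_iff a ha.1).1 ha.2, fun ha => ⟨hs ha, (h.eq_iff a (hs ha)).2 ha⟩⟩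

theorem prod {A' s' : Set β} {ω' η' : β → ℝ} (h : IsLowerSupport A ω η s)
    (h' : IsLowerSupport A' ω' η' s') :
    IsLowerSupport (A ×ˢ A') (fun x => ω x.1 + ω' x.2) (fun x => η x.1 + η' x.2) (s ×ˢ s') where
  le x hx := add_le_add (h.le _ hx.1) (h'.le _ hx.2)
  eq_iff x hx := by
    rw [eq_comm, add_eq_add_iff_eq_and_eq (h.le _ hx.1) (h'.le _ hx.2), Set.mem_prod,
      ← h.eq_iff _ hx.1, ← h'.eq_iff _ hx.2, eq_comm, @eq_comm _ (η' _)]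

theorem sum {ι : Type*} {C : Finset ι} {ω η : ι → α → ℝ} {s : ι → Set α}
    (h : ∀ c ∈ C, IsLowerSupport A (ω c) (η c) (s c)) :
    IsLowerSupport A (fun a => ∑ c ∈ C, ω c a) (fun a => ∑ c ∈ C, η c a)
      {a | ∀ c ∈ C, a ∈ s c} where
  le a ha := Finset.sum_le_sum fun c hc => (h c hc).le a ha
  eq_iff a ha := by
    rw [eq_comm, Finset.sum_eq_sum_iff_of_le fun c hc => (h c hc).le a ha]
    exact forall₂_congr fun c hc => eq_comm.trans ((h c hc).eq_iff a ha)

theorem eventually_perturb (hA : A.Finite) (h : IsLowerSupport A ω η t)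
    (h' : IsLowerSupport (A ∩ t) θ ζ s) (hst : A ∩ s ⊆ t) :
    ∀ᶠ ε in 𝓝[>] (0 : ℝ), IsLowerSupport A (ω + ε • θ) (η + ε • ζ) s := by
  have at_point : ∀ a ∈ A, ∀ᶠ ε in 𝓝[>] (0 : ℝ),
      (η + ε • ζ) a ≤ (ω + ε • θ) a ∧ ((ω + ε • θ) a = (η + ε • ζ) a ↔ a ∈ s) := by
    intro a ha
    by_cases hat : a ∈ t
    · filter_upwards [self_mem_nhdsWithin] with ε hε
      rw [Set.mem_Ioi] at hε
      simp only [Pi.add_apply, Pi.smul_apply, (h.eq_iff a ha).2 hat, add_le_add_iff_left,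
        add_right_inj, smul_eq_mul, ← h'.eq_iff a ⟨ha, hat⟩, mul_right_inj' hε.ne', and_true]
      exact mul_le_mul_of_nonneg_left (h'.le a ⟨ha, hat⟩) hε.le
    · have lt : η a < ω a := (h.le a ha).lt_of_ne' (mt (h.eq_iff a ha).1 hat)
      have tendsto (p q : ℝ) : Tendsto (fun ε : ℝ => p + ε * q) (𝓝[>] 0) (𝓝 p) :=
        tendsto_nhdsWithin_of_tendsto_nhds (Continuous.tendsto' (by fun_prop) _ _ (by simp))
      filter_upwards [(tendsto _ (ζ a)).eventually_lt (tendsto _ (θ a)) lt] with ε hε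
      exact ⟨hε.le, iff_of_false hε.ne' fun has => hat (hst ⟨ha, has⟩)⟩
  filter_upwards [(eventually_all_finite hA).2 at_point] with ε hε
  exact ⟨fun a ha => (hε a ha).1, fun a ha => (hε a ha).2⟩

end IsLowerSupport

theorem linearCombination_mono_on_support {w : α →₀ ℝ} (hw : 0 ≤ w) {f g : α → ℝ}
    (h : ∀ a ∈ w.support, f a ≤ g a) :
    Finsupp.linearCombination ℝ f w ≤ Finsupp.linearCombination ℝ g w :=
  Finset.sum_le_sum fun a ha => smul_le_smul_of_nonneg_left (h a ha) (hw a)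

theorem eq_on_support_of_linearCombination_eq {w : α →₀ ℝ} (hw : 0 ≤ w) {f g : α → ℝ}
    (h : ∀ a ∈ w.support, f a ≤ g a)
    (he : Finsupp.linearCombination ℝ f w = Finsupp.linearCombination ℝ g w) :
    ∀ a ∈ w.support, f a = g a := fun a ha =>
  smul_right_injective _ (Finsupp.mem_support_iff.1 ha) <|
    (Finset.sum_eq_sum_iff_of_le fun a ha => smul_le_smul_of_nonneg_left (h a ha) (hw a)).1 he a ha

variable {E : Type*} [AddCommGroup E] [Module ℝ E] {Λ : AddSubgroup E}
  {K : SimplicialComplex ℝ E} {P : Set E}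

theorem IsLowerSupport.support_subset_of_barycenter_eq {A s t : Set E} {ω : E → ℝ}
    {η ζ : E →ᵃ[ℝ] ℝ} (h : IsLowerSupport A ω η s) (h' : IsLowerSupport A ω ζ t) {u w : E →₀ ℝ}
    (hu : IsConvexWeight u) (hw : IsConvexWeight w) (hb : barycenter u = barycenter w)
    (hus : (u.support : Set E) ⊆ A ∩ s) (hwt : (w.support : Set E) ⊆ A ∩ t) :
    (u.support : Set E) ⊆ t := by
  have apply_barycenter_le : η (barycenter w) ≤ ζ (barycenter w) := by
    rw [← linearCombination_affineMap η hw.totalMass_eq_one,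
      ← linearCombination_affineMap ζ hw.totalMass_eq_one]
    exact linearCombination_mono_on_support hw.nonneg fun a ha =>
      (h.le a (hwt ha).1).trans_eq ((h'.eq_iff a (hwt ha).1).2 (hwt ha).2)
  have sum_eq : Finsupp.linearCombination ℝ ζ u = Finsupp.linearCombination ℝ ω u := by
    refine (linearCombination_mono_on_support hu.nonneg fun a ha =>
      h'.le a (hus ha).1).antisymm ?_
    calc
      Finsupp.linearCombination ℝ ω u ≤ Finsupp.linearCombination ℝ η u :=
        linearCombination_mono_on_support hu.nonneg fun a ha =>
          ((h.eq_iff a (hus ha).1).2 (hus ha).2).le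
      _ = η (barycenter w) := by rw [linearCombination_affineMap η hu.totalMass_eq_one, hb]
      _ ≤ ζ (barycenter w) := apply_barycenter_le
      _ = Finsupp.linearCombination ℝ ζ u := by
        rw [linearCombination_affineMap ζ hu.totalMass_eq_one, hb]
  exact fun a ha => (h'.eq_iff a (hus ha).1).1 <| Eq.symm <|
    eq_on_support_of_linearCombination_eq hu.nonneg (fun a ha => h'.le a (hus ha).1) sum_eq a ha

theorem IsRegularTriangulation.exists_isLowerSupport (h : IsRegularTriangulation Λ K)
    (hK : IsUnimodularTriangulation Λ K P) :
    ∃ ω : E → ℝ, ∀ s ∈ K.faces, ∃ η : E →ᵃ[ℝ] ℝ, IsLowerSupport (K.space ∩ Λ) ω η s := by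
  classical
  obtain ⟨ω, hω⟩ := h
  refine ⟨ω, fun s hs => ?_⟩
  have hull_nonempty : (convexHull ℝ (s : Set E)).Nonempty := by
    simpa using K.nonempty_of_mem_faces hs
  obtain ⟨η, hη, hull_eq⟩ := (hω _ hull_nonempty).2 ⟨s, hs, rfl⟩
  have touching_subset : {a | a ∈ K.space ∩ Λ ∧ ω a = η a} ⊆ s := fun a ha =>
    (hK.isUnimodularSimplex hs).mem_of_mem_convexHull ha.1.2
      (hull_eq ▸ subset_convexHull ℝ _ ha)
  obtain ⟨t, ht⟩ := (s.finite_toSet.subset touching_subset).exists_finset_coe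
  rw [← ht] at touching_subset hull_eq
  have ht_faces : t ∈ K.faces := K.down_closed hs (Finset.coe_subset.1 touching_subset)
    (by simpa [hull_eq] using hull_nonempty)
  have hst : (s : Set E) ⊆ t :=
    Finset.coe_subset.2 ((K.face_subset_face_iff hs ht_faces).1 hull_eq.subset)
  refine ⟨η, hη, fun a ha => ⟨fun h => touching_subset (ht ▸ ⟨ha, h⟩), fun has => ?_⟩⟩
  exact (ht ▸ hst has : a ∈ {a | a ∈ K.space ∩ Λ ∧ ω a = η a}).2

theorem IsUnimodularTriangulation.isRegularTriangulation_of_isLowerSupport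
    (hK : IsUnimodularTriangulation Λ K P) (hP : Convex ℝ P) {ω : E → ℝ}
    (hω : ∀ s ∈ K.faces, ∃ η : E →ᵃ[ℝ] ℝ, IsLowerSupport (K.space ∩ Λ) ω η s) :
    IsRegularTriangulation Λ K := by
  refine ⟨ω, fun C hC => ⟨?_, ?_⟩⟩
  · rintro ⟨η, hη, rfl⟩
    have hfin : {a | a ∈ K.space ∩ Λ ∧ ω a = η a}.Finite :=
      hK.finite_space_inter.subset fun a ha => ha.1
    obtain ⟨t, ht⟩ := hfin.exists_finset_coe
    rw [← ht] at hC ⊢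
    obtain ⟨u, hu, rfl⟩ := exists_isConvexWeight_support_eq (by simpa using hC)
    have hη : IsLowerSupport (K.space ∩ Λ) ω η {a | ω a = η a} := ⟨hη, fun _ _ => Iff.rfl⟩
    have mem_space : barycenter u ∈ K.space := by
      refine convexHull_min ?_ (hK.2.1 ▸ hP) (mem_convexHull_finset_iff.2 ⟨u, hu, subset_rfl, rfl⟩)
      exact ht ▸ fun a ha => ha.1.1
    obtain ⟨w, hw, hws, hb⟩ := mem_space_iff_exists_convexWeight.1 mem_space
    obtain ⟨ζ, hζ⟩ := hω _ hws
    have hwA := hK.coe_subset_space_inter hws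
    have support_u_le := hη.support_subset_of_barycenter_eq hζ hu hw hb.symm ht.subset
      (Set.subset_inter hwA subset_rfl)
    have support_w_le := hζ.support_subset_of_barycenter_eq hη hw hu hb
      (Set.subset_inter hwA subset_rfl) ht.subset
    exact ⟨w.support, hws, congrArg _ (support_u_le.antisymm fun a ha =>
      ht ▸ ⟨hwA ha, support_w_le ha⟩)⟩
  · rintro ⟨s, hs, rfl⟩
    obtain ⟨η, hη⟩ := hω s hs
    exact ⟨η, hη.le, by rw [hη.setOf_eq (hK.coe_subset_space_inter hs)]⟩

theorem IsUnimodularTriangulation.isRegularTriangulation_of_lex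
    (hK : IsUnimodularTriangulation Λ K P) (hP : Convex ℝ P) {ω θ : E → ℝ}
    (h : ∀ s ∈ K.faces, ∃ (η ζ : E →ᵃ[ℝ] ℝ) (t : Set E), (s : Set E) ⊆ t ∧
      IsLowerSupport (K.space ∩ Λ) ω η t ∧ IsLowerSupport (K.space ∩ Λ ∩ t) θ ζ s) :
    IsRegularTriangulation Λ K := by
  choose! η ζ t hst hη hζ using h
  obtain ⟨ε, hε⟩ := ((eventually_all_finite hK.1).2 fun s hs =>
    (hη s hs).eventually_perturb hK.finite_space_inter (hζ s hs)
      (Set.inter_subset_right.trans (hst s hs))).exists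
  exact hK.isRegularTriangulation_of_isLowerSupport hP fun s hs =>
    ⟨η s + ε • ζ s, by simpa using hε s hs⟩

end Regularity

section StaircaseHeights

variable {α β : Type*}

theorem exists_isLowerSupport_neg_indicator_prod (A : Set α) (B : Set β) {p q : Prop}
    (hpq : p ∨ q) :
    ∃ (f : α → ℝ) (g : β → ℝ),
      IsLowerSupport Set.univ (fun x => -(A ×ˢ B).indicator 1 x) (fun x => f x.1 + g x.2)
        {x | (p → x.2 ∈ B → x.1 ∈ A) ∧ (q → x.1 ∈ A → x.2 ∈ B)} := by
  classical
  -- `-1` on `A ×ˢ B` is the maximum of `-1` on `A` and `-1` on `B` (pulled back to the product),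
  -- so it dominates each of their convex combinations; the weights decide where it is touched.
  obtain ⟨r, r', hr, hr', sum_eq, hp, hq⟩ :
      ∃ r r' : ℝ, 0 ≤ r ∧ 0 ≤ r' ∧ -r + -r' = -1 ∧ (r' = 0 ↔ ¬p) ∧ (r = 0 ↔ ¬q) := by
    by_cases hp : p
    · by_cases hq : q
      · exact ⟨1 / 2, 1 / 2, by norm_num [hp, hq]⟩
      · exact ⟨0, 1, by norm_num [hp, hq]⟩
    · exact ⟨1, 0, by norm_num [hp, hpq.resolve_left hp]⟩
  refine ⟨fun a => -(r * A.indicator 1 a), fun b => -(r' * B.indicator 1 b), ?_, ?_⟩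
  · intro x _
    by_cases hA : x.1 ∈ A <;> by_cases hB : x.2 ∈ B <;> simp [hA, hB, hr, hr', sum_eq]
  · intro x _
    by_cases hA : x.1 ∈ A <;> by_cases hB : x.2 ∈ B <;> simp [hA, hB, hp, hq, sum_eq]

/-- Heights that induce the staircase triangulations: a point is lowered by the number of elements
of `C` below it. -/
noncomputable def staircaseHeight [Preorder α] [Preorder β] (C : Finset (α × β)) (x : α × β) : ℝ :=
  ∑ c ∈ C, -(Set.Ici c).indicator 1 x

theorem exists_eq_and_le_of_threshold {ι : Type*} [LinearOrder α] [PartialOrder β] {N : Finset ι}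
    {f : ι → α} {g : ι → β} (hN : IsChain (fun i j => f i ≤ f j ∧ g i ≤ g j) (N : Set ι)) {a : α}
    {b : β} (hb : b ∈ g '' N)
    (h : ∀ c ∈ N, (∀ i ∈ N, g c ≤ g i → f c ≤ f i) → g c ≤ b → f c ≤ a) :
    ∃ i ∈ N, g i = b ∧ f i ≤ a := by
  classical
  have fiber_nonempty : {i ∈ N | g i = b}.Nonempty := by
    obtain ⟨i, hi, hib⟩ := hb
    exact ⟨i, Finset.mem_filter.2 ⟨hi, hib⟩⟩
  obtain ⟨c, hc, c_min⟩ := Finset.exists_min_image _ f fiber_nonempty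
  obtain ⟨hcN, rfl⟩ := Finset.mem_filter.1 hc
  refine ⟨c, hcN, rfl, h c hcN (fun i hi hci => ?_) le_rfl⟩
  have : Std.Refl fun i j => f i ≤ f j ∧ g i ≤ g j := ⟨fun _ => ⟨le_rfl, le_rfl⟩⟩
  rcases hN.total hcN hi with h | h
  · exact h.1
  · exact c_min i (Finset.mem_filter.2 ⟨hi, h.2.antisymm hci⟩)

theorem mem_of_forall_threshold [LinearOrder α] [LinearOrder β] {N : Finset (α × β)}
    (hN : IsChain (· ≤ ·) (N : Set (α × β))) {x : α × β}
    (hx : x ∈ (Prod.fst '' (N : Set (α × β))) ×ˢ (Prod.snd '' (N : Set (α × β))))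
    (h₁ : ∀ c ∈ N, (∀ y ∈ N, c.2 ≤ y.2 → c.1 ≤ y.1) → c.2 ≤ x.2 → c.1 ≤ x.1)
    (h₂ : ∀ c ∈ N, (∀ y ∈ N, c.1 ≤ y.1 → c.2 ≤ y.2) → c.1 ≤ x.1 → c.2 ≤ x.2) : x ∈ N := by
  obtain ⟨y, hy, y_snd, y_fst⟩ := exists_eq_and_le_of_threshold hN hx.2 h₁
  obtain ⟨z, hz, z_fst, z_snd⟩ := exists_eq_and_le_of_threshold
    (hN.mono_rel fun _ _ h => ⟨h.2, h.1⟩) hx.1 h₂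
  rcases hN.total hy hz with hyz | hzy
  · have : z = x := Prod.ext z_fst (z_snd.antisymm (y_snd ▸ hyz.2))
    exact this ▸ hz
  · have : y = x := Prod.ext (y_fst.antisymm (z_fst ▸ hzy.1)) y_snd
    exact this ▸ hy

theorem exists_isLowerSupport_staircaseHeight [LinearOrder α] [LinearOrder β]
    {C N : Finset (α × β)} (hN : IsChain (· ≤ ·) (N : Set (α × β))) (hNC : N ⊆ C) :
    ∃ (f : α → ℝ) (g : β → ℝ),
      IsLowerSupport ((Prod.fst '' (N : Set (α × β))) ×ˢ (Prod.snd '' (N : Set (α × β))))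
        (staircaseHeight C) (fun x => f x.1 + g x.2) N := by
  have implication (c : α × β) : (∀ y ∈ N, c.2 ≤ y.2 → c.1 ≤ y.1) ∨
      ∀ y ∈ N, c.1 ≤ y.1 → c.2 ≤ y.2 := by
    refine (fst_mem_imp_snd_mem_or_snd_mem_imp_fst_mem hN (isUpperSet_Ici c.1).compl
      (isUpperSet_Ici c.2).compl).imp (fun h y hy => ?_) fun h y hy => ?_
    exacts [not_imp_not.1 (h y hy), not_imp_not.1 (h y hy)]
  choose f g hfg using fun c : α × β =>
    exists_isLowerSupport_neg_indicator_prod (Set.Ici c.1) (Set.Ici c.2) (implication c)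
  simp only [Set.Ici_prod_Ici, Set.mem_Ici] at hfg
  refine ⟨fun a => ∑ c ∈ C, f c a, fun b => ∑ c ∈ C, g c b,
    ((IsLowerSupport.sum fun c _ => hfg c).mono (Set.subset_univ _)).congr
      (fun x _ => Finset.sum_add_distrib) fun x hx => ⟨fun h => ?_, fun hxN c _ => ?_⟩⟩
  · exact mem_of_forall_threshold hN hx (fun c hc => (h c (hNC hc)).1) fun c hc => (h c (hNC hc)).2
  · exact ⟨fun h => h x hxN, fun h => h x hxN⟩

end StaircaseHeights

section Staircase

open Geometry

variable {E E' F : Type*} [AddCommGroup E] [Module ℝ E] [AddCommGroup E'] [Module ℝ E']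
  [LinearOrder E] [LinearOrder E'] {S : SimplicialComplex ℝ E} {S' : SimplicialComplex ℝ E'}

/-- The faces of the staircase triangulation of a fiber product: chains in the product order that
project to faces of `S` and `S'` and consist of points of the fiber product. -/
structure IsStaircase (f : E → F) (g : E' → F) (S : SimplicialComplex ℝ E)
    (S' : SimplicialComplex ℝ E') (N : Finset (E × E')) : Prop where
  image_fst_mem : N.image Prod.fst ∈ S.faces
  image_snd_mem : N.image Prod.snd ∈ S'.faces
  isChain : IsChain (· ≤ ·) (N : Set (E × E'))
  apply_eq : ∀ x ∈ N, f x.1 = g x.2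

section

variable {f : E → F} {g : E' → F} {N : Finset (E × E')}

theorem isRelLowerSet_isStaircase (f : E → F) (g : E' → F) (S : SimplicialComplex ℝ E)
    (S' : SimplicialComplex ℝ E') :
    IsRelLowerSet {N | IsStaircase f g S S' N} Finset.Nonempty := fun N hN =>
  ⟨by simpa using S.nonempty_of_mem_faces hN.image_fst_mem, fun M hMN hM =>
    { image_fst_mem :=
        S.down_closed hN.image_fst_mem (Finset.image_subset_image hMN) (hM.image _)
      image_snd_mem :=
        S'.down_closed hN.image_snd_mem (Finset.image_subset_image hMN) (hM.image _)
      isChain := hN.isChain.mono (Finset.coe_subset.2 hMN)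
      apply_eq := fun x hx => hN.apply_eq x (hMN hx) }⟩

theorem IsStaircase.support_mapDomain_fst_mem {w : E × E' →₀ ℝ}
    (h : IsStaircase f g S S' w.support) (hw : 0 ≤ w) :
    (w.mapDomain Prod.fst).support ∈ S.faces :=
  support_mapDomain_of_nonneg hw Prod.fst ▸ h.image_fst_mem

theorem IsStaircase.support_mapDomain_snd_mem {w : E × E' →₀ ℝ}
    (h : IsStaircase f g S S' w.support) (hw : 0 ≤ w) :
    (w.mapDomain Prod.snd).support ∈ S'.faces :=
  support_mapDomain_of_nonneg hw Prod.snd ▸ h.image_snd_mem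

theorem injOn_barycenter_isStaircase (f : E → F) (g : E' → F) (S : SimplicialComplex ℝ E)
    (S' : SimplicialComplex ℝ E') :
    Set.InjOn barycenter
      {w : E × E' →₀ ℝ | IsConvexWeight w ∧ w.support ∈ {N | IsStaircase f g S S' N}} := by
  rintro w ⟨hw, hN⟩ w' ⟨hw', hN'⟩ hb
  have fst_eq : w.mapDomain Prod.fst = w'.mapDomain Prod.fst :=
    convexWeight_unique_of_support_mem_faces S (hw.mapDomain _) (hw'.mapDomain _)
      (hN.support_mapDomain_fst_mem hw.nonneg) (hN'.support_mapDomain_fst_mem hw'.nonneg)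
      (by rw [barycenter_mapDomain_fst, barycenter_mapDomain_fst, hb])
  have snd_eq : w.mapDomain Prod.snd = w'.mapDomain Prod.snd :=
    convexWeight_unique_of_support_mem_faces S' (hw.mapDomain _) (hw'.mapDomain _)
      (hN.support_mapDomain_snd_mem hw.nonneg) (hN'.support_mapDomain_snd_mem hw'.nonneg)
      (by rw [barycenter_mapDomain_snd, barycenter_mapDomain_snd, hb])
  have coupling : IsMonotoneCoupling _ _ w := ⟨hw.nonneg, rfl, rfl, hN.isChain⟩
  exact coupling.unique ⟨hw'.nonneg, fst_eq.symm, snd_eq.symm, hN'.isChain⟩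

/-- The staircase triangulation of the fiber product of two triangulated sets over the maps `f`
and `g`, with respect to linear orders on the two ambient spaces. -/
def staircaseComplex (f : E → F) (g : E' → F) (S : SimplicialComplex ℝ E)
    (S' : SimplicialComplex ℝ E') : SimplicialComplex ℝ (E × E') :=
  simplicialComplexOfInjOnBarycenter {N | IsStaircase f g S S' N}
    (isRelLowerSet_isStaircase f g S S') (injOn_barycenter_isStaircase f g S S')

theorem mem_staircaseComplex_faces :
    N ∈ (staircaseComplex f g S S').faces ↔ IsStaircase f g S S' N := Iff.rfl

theorem finite_faces_staircaseComplex (hS : S.faces.Finite) (hS' : S'.faces.Finite) :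
    (staircaseComplex f g S S').faces.Finite := by
  refine (hS.biUnion fun s _ => hS'.biUnion fun s' _ =>
    (s ×ˢ s').powerset.finite_toSet).subset fun N hN => ?_
  exact Set.mem_biUnion hN.image_fst_mem <| Set.mem_biUnion hN.image_snd_mem <|
    Finset.mem_powerset.2 Finset.subset_product

theorem IsStaircase.isUnimodularSimplex {Λ : AddSubgroup E} {Λ' : AddSubgroup E'}
    (hN : IsStaircase f g S S' N) (h : IsUnimodularSimplex Λ (N.image Prod.fst))
    (h' : IsUnimodularSimplex Λ' (N.image Prod.snd)) : IsUnimodularSimplex (Λ.prod Λ') N := by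
  refine isUnimodularSimplex_of_apply_mem_range_intCast
    ((staircaseComplex f g S S').indep hN)
    (fun x hx => ⟨h.2.1 (Finset.mem_image_of_mem _ hx), h'.2.1 (Finset.mem_image_of_mem _ hx)⟩)
    fun w hwN hw hb => ?_
  refine apply_mem_of_mapDomain_mem _ (hN.isChain.mono (Finset.coe_subset.2 hwN)) ?_ ?_
  · exact h.apply_mem_range_intCast
      (Finsupp.mapDomain_support.trans (Finset.image_subset_image hwN)) (by simpa using hw)
      (barycenter_mapDomain_fst w ▸ hb.1)
  · exact h'.apply_mem_range_intCast
      (Finsupp.mapDomain_support.trans (Finset.image_subset_image hwN)) (by simpa using hw)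
      (barycenter_mapDomain_snd w ▸ hb.2)

end

variable [AddCommGroup F] [Module ℝ F] {π : E →ᵃ[ℝ] F} {π' : E' →ᵃ[ℝ] F}

theorem staircaseComplex_space_subset :
    (staircaseComplex π π' S S').space ⊆ fiberProduct π π' S.space S'.space := by
  intro x hx
  obtain ⟨w, hw, hN, rfl⟩ := mem_space_iff_exists_convexWeight.1 hx
  rw [mem_staircaseComplex_faces] at hN
  rw [fiberProduct, Set.mem_ofPred_eq, ← barycenter_mapDomain_fst, ← barycenter_mapDomain_snd]
  refine ⟨mem_space_iff_exists_convexWeight.2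
      ⟨_, hw.mapDomain _, hN.support_mapDomain_fst_mem hw.nonneg, rfl⟩,
    mem_space_iff_exists_convexWeight.2
      ⟨_, hw.mapDomain _, hN.support_mapDomain_snd_mem hw.nonneg, rfl⟩, ?_⟩
  rw [← barycenter_mapDomain_affineMap π (hw.mapDomain _).totalMass_eq_one,
    ← barycenter_mapDomain_affineMap π' (hw.mapDomain _).totalMass_eq_one,
    ← Finsupp.mapDomain_comp, ← Finsupp.mapDomain_comp]
  exact congrArg _ (Finsupp.mapDomain_congr hN.apply_eq)

theorem fiberProduct_subset_staircaseComplex_space [LinearOrder F] (hπ : Monotone π)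
    (hπ' : Monotone π') {T : SimplicialComplex ℝ F} (hST : ∀ s ∈ S.faces, s.image π ∈ T.faces)
    (hST' : ∀ s ∈ S'.faces, s.image π' ∈ T.faces) :
    fiberProduct π π' S.space S'.space ⊆ (staircaseComplex π π' S S').space := by
  rintro ⟨p, p'⟩ ⟨hp, hp', hpp'⟩
  obtain ⟨u, hu, hus, rfl⟩ := mem_space_iff_exists_convexWeight.1 hp
  obtain ⟨v, hv, hvs, rfl⟩ := mem_space_iff_exists_convexWeight.1 hp'
  have hu1 := hu.totalMass_eq_one
  have hv1 := hv.totalMass_eq_one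
  have pushforward_eq : u.mapDomain π = v.mapDomain π' := by
    refine convexWeight_unique_of_support_mem_faces T (hu.mapDomain _) (hv.mapDomain _) ?_ ?_ ?_
    · exact support_mapDomain_of_nonneg hu.nonneg π ▸ hST _ hus
    · exact support_mapDomain_of_nonneg hv.nonneg π' ▸ hST' _ hvs
    · rw [barycenter_mapDomain_affineMap _ hu1, barycenter_mapDomain_affineMap _ hv1]
      exact hpp'
  obtain ⟨w, hw⟩ := exists_isMonotoneCoupling hu.nonneg hv.nonneg (hu1.trans hv1.symm)
  refine mem_space_iff_exists_convexWeight.2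
    ⟨w, ⟨hw.nonneg, by rw [← hu1, ← hw.mapDomain_fst, totalMass_mapDomain]⟩, ?_, ?_⟩
  · exact
      { image_fst_mem := hw.image_fst_support ▸ hus
        image_snd_mem := hw.image_snd_support ▸ hvs
        isChain := hw.isChain_support
        apply_eq := fun x hx => hw.map_fst_eq_map_snd hπ hπ' pushforward_eq hx }
  · exact Prod.ext (by rw [← barycenter_mapDomain_fst, hw.mapDomain_fst])
      (by rw [← barycenter_mapDomain_snd, hw.mapDomain_snd])

variable {Λ : AddSubgroup E} {Λ' : AddSubgroup E'} {P : Set E} {P' : Set E'}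

theorem isUnimodularTriangulation_staircaseComplex [LinearOrder F]
    (hS : IsUnimodularTriangulation Λ S P) (hS' : IsUnimodularTriangulation Λ' S' P')
    (hπ : Monotone π) (hπ' : Monotone π') {T : SimplicialComplex ℝ F}
    (hST : ∀ s ∈ S.faces, s.image π ∈ T.faces) (hST' : ∀ s ∈ S'.faces, s.image π' ∈ T.faces) :
    IsUnimodularTriangulation (Λ.prod Λ') (staircaseComplex π π' S S')
      (fiberProduct π π' P P') := by
  obtain rfl := hS.2.1
  obtain rfl := hS'.2.1
  refine ⟨finite_faces_staircaseComplex hS.1 hS'.1, staircaseComplex_space_subset.antisymm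
    (fiberProduct_subset_staircaseComplex_space hπ hπ' hST hST'), fun N hN => ?_⟩
  have hN := mem_staircaseComplex_faces.1 hN.1
  exact hN.isUnimodularSimplex (hS.isUnimodularSimplex hN.image_fst_mem)
    (hS'.isUnimodularSimplex hN.image_snd_mem)

end Staircase

section StaircaseRegularity

open Geometry

variable {E E' F : Type*} [AddCommGroup E] [Module ℝ E] [AddCommGroup E'] [Module ℝ E']

theorem convex_fiberProduct [AddCommGroup F] [Module ℝ F] (π : E →ᵃ[ℝ] F) (π' : E' →ᵃ[ℝ] F)
    {P : Set E} {P' : Set E'} (hP : Convex ℝ P) (hP' : Convex ℝ P') :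
    Convex ℝ (fiberProduct π π' P P') := by
  rintro x ⟨hx, hx', hxx⟩ y ⟨hy, hy', hyy⟩ a b ha hb hab
  refine ⟨hP hx hy ha hb hab, hP' hx' hy' ha hb hab, ?_⟩
  rw [Prod.fst_add, Prod.snd_add, Prod.smul_fst, Prod.smul_fst, Prod.smul_snd, Prod.smul_snd,
    Convex.combo_affine_apply hab, Convex.combo_affine_apply hab, hxx, hyy]

variable [LinearOrder E] [LinearOrder E'] {S : SimplicialComplex ℝ E}
  {S' : SimplicialComplex ℝ E'}

theorem IsStaircase.exists_affineMap_isLowerSupport_staircaseHeight {f : E → F} {g : E' → F}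
    {N C : Finset (E × E')} (hN : IsStaircase f g S S' N) (hNC : N ⊆ C) :
    ∃ ζ : E × E' →ᵃ[ℝ] ℝ,
      IsLowerSupport ((Prod.fst '' (N : Set (E × E'))) ×ˢ (Prod.snd '' (N : Set (E × E'))))
        (staircaseHeight C) ζ N := by
  obtain ⟨p, q, hpq⟩ := exists_isLowerSupport_staircaseHeight hN.isChain hNC
  obtain ⟨φ, hφ⟩ := exists_affineMap_eqOn_of_affineIndependent (S.indep hN.image_fst_mem) p
  obtain ⟨φ', hφ'⟩ := exists_affineMap_eqOn_of_affineIndependent (S'.indep hN.image_snd_mem) q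
  rw [Finset.coe_image] at hφ hφ'
  exact ⟨φ.comp AffineMap.fst + φ'.comp AffineMap.snd, hpq.congr
    (fun x hx => by simp [hφ hx.1, hφ' hx.2]) fun _ _ => Iff.rfl⟩

theorem isRegularTriangulation_staircaseComplex [AddCommGroup F] [Module ℝ F] {π : E →ᵃ[ℝ] F}
    {π' : E' →ᵃ[ℝ] F} {Λ : AddSubgroup E} {Λ' : AddSubgroup E'} {P : Set E} {P' : Set E'}
    (hS : IsUnimodularTriangulation Λ S P) (hS' : IsUnimodularTriangulation Λ' S' P')
    (hP : Convex ℝ P) (hP' : Convex ℝ P')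
    (hU : IsUnimodularTriangulation (Λ.prod Λ') (staircaseComplex π π' S S')
      (fiberProduct π π' P P'))
    (hreg : IsRegularTriangulation Λ S) (hreg' : IsRegularTriangulation Λ' S') :
    IsRegularTriangulation (Λ.prod Λ') (staircaseComplex π π' S S') := by
  obtain ⟨ω, hω⟩ := hreg.exists_isLowerSupport hS
  obtain ⟨ω', hω'⟩ := hreg'.exists_isLowerSupport hS'
  refine hU.isRegularTriangulation_of_lex (convex_fiberProduct π π' hP hP')
    (ω := fun x => ω x.1 + ω' x.2) (θ := staircaseHeight hU.finite_space_inter.toFinset)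
    fun N hN => ?_
  obtain ⟨η, hη⟩ := hω _ hN.image_fst_mem
  obtain ⟨η', hη'⟩ := hω' _ hN.image_snd_mem
  obtain ⟨ζ, hζ⟩ := hN.exists_affineMap_isLowerSupport_staircaseHeight
    (hU.finite_space_inter.subset_toFinset.2 (hU.coe_subset_space_inter hN))
  rw [Finset.coe_image] at hη hη'
  refine ⟨η.comp AffineMap.fst + η'.comp AffineMap.snd, ζ, _, ?_,
    (hη.prod hη').mono fun x hx => ?_, hζ.mono Set.inter_subset_right⟩
  · exact fun x hx => ⟨Set.mem_image_of_mem _ hx, Set.mem_image_of_mem _ hx⟩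
  · have := staircaseComplex_space_subset hx.1
    exact ⟨⟨this.1, hx.2.1⟩, this.2.1, hx.2.2⟩

end StaircaseRegularity

section MinimalNonfaces

open Geometry

variable {E E' F G : Type*} [AddCommGroup E] [Module ℝ E] [AddCommGroup E'] [Module ℝ E']
  [AddCommGroup F] [Module ℝ F] [AddCommGroup G] [Module ℝ G]

theorem exists_isMinimalNonface_subset {S : SimplicialComplex ℝ E} {Λ : AddSubgroup E}
    {s : Finset E} (hs : s.Nonempty) (hsΛ : (s : Set E) ⊆ S.space ∩ Λ) (hsS : s ∉ S.faces) :
    ∃ M ⊆ s, IsMinimalNonface Λ S M := by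
  obtain ⟨M, hMs, hM⟩ :=
    exists_minimal_le_of_wellFoundedLT (fun M => M.Nonempty ∧ M ∉ S.faces) s ⟨hs, hsS⟩
  refine ⟨M, hMs, hM.prop.1, (Finset.coe_subset.2 hMs).trans hsΛ, hM.prop.2, fun L hLM hL => ?_⟩
  by_contra hLS
  exact hM.not_prop_of_lt hLM ⟨hL, hLS⟩

theorem IsMinimalNonface.exists_isMinimalNonface_card_eq_of_image [DecidableEq E]
    {U : SimplicialComplex ℝ G} {Γ : AddSubgroup G} {N : Finset G} (hN : IsMinimalNonface Γ U N)
    {S : SimplicialComplex ℝ E} {Λ : AddSubgroup E} {f : G → E}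
    (hf : ∀ s ∈ U.faces, s.image f ∈ S.faces) (hfΛ : ∀ x ∈ N, f x ∈ S.space ∩ Λ)
    (hfN : N.image f ∉ S.faces) :
    ∃ M : Finset E, IsMinimalNonface Λ S M ∧ M.card = N.card := by
  obtain ⟨M, hMN, hM⟩ := exists_isMinimalNonface_subset (hN.1.image f)
    (by simpa [Set.subset_def] using hfΛ) hfN
  obtain ⟨L, hLN, hinj, rfl⟩ := Finset.exists_subset_injOn_image_eq_of_surjOn N M (f := f)
    (by simpa [Set.SurjOn] using Finset.coe_subset.2 hMN)
  obtain rfl | hLN := (Finset.coe_subset.1 hLN).eq_or_ssubset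
  · exact ⟨_, hM, Finset.card_image_of_injOn hinj⟩
  · exact absurd (hf L (hN.2.2.2 L hLN (Finset.image_nonempty.1 hM.1))) hM.2.2.1

theorem IsMinimalNonface.card_eq_two_or_of_staircaseComplex [LinearOrder E] [LinearOrder E']
    {π : E →ᵃ[ℝ] F} {π' : E' →ᵃ[ℝ] F} {S : SimplicialComplex ℝ E} {S' : SimplicialComplex ℝ E'}
    {Λ : AddSubgroup E} {Λ' : AddSubgroup E'} {N : Finset (E × E')}
    (hN : IsMinimalNonface (Λ.prod Λ') (staircaseComplex π π' S S') N) :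
    N.card = 2 ∨ (∃ M : Finset E, IsMinimalNonface Λ S M ∧ M.card = N.card) ∨
      ∃ M' : Finset E', IsMinimalNonface Λ' S' M' ∧ M'.card = N.card := by
  have mem_fiberProduct (x) (hx : x ∈ N) : x ∈ fiberProduct π π' S.space S'.space :=
    staircaseComplex_space_subset (hN.2.1 hx).1
  refine or_iff_not_imp_left.2 fun card_ne => ?_
  have isChain : IsChain (· ≤ ·) (N : Set (E × E')) := by
    intro x hx y hy hxy
    have pair_ssubset : {x, y} ⊂ N := by
      refine (Finset.insert_subset hx (Finset.singleton_subset_iff.2 hy)).ssubset_of_ne ?_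
      rintro rfl
      exact card_ne (Finset.card_pair hxy)
    exact (hN.2.2.2 _ pair_ssubset (by simp)).isChain (by simp) (by simp) hxy
  by_cases fst_mem : N.image Prod.fst ∈ S.faces
  · refine Or.inr <| hN.exists_isMinimalNonface_card_eq_of_image (fun s hs => hs.image_snd_mem)
      (fun x hx => ⟨(mem_fiberProduct x hx).2.1, (hN.2.1 hx).2.2⟩) fun snd_mem => ?_
    exact hN.2.2.1 ⟨fst_mem, snd_mem, isChain, fun x hx => (mem_fiberProduct x hx).2.2⟩
  · exact Or.inl <| hN.exists_isMinimalNonface_card_eq_of_image (fun s hs => hs.image_fst_mem)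
      (fun x hx => ⟨(mem_fiberProduct x hx).1, (hN.2.1 hx).2.1⟩) fst_mem

end MinimalNonfaces

theorem Refines.image_mem_faces {E F : Type*} [AddCommGroup E] [Module ℝ E] [AddCommGroup F]
    [Module ℝ F] [DecidableEq F] {Λ : AddSubgroup E} {M : AddSubgroup F} {π : E →ᵃ[ℝ] F}
    {P : Set E} {S : Geometry.SimplicialComplex ℝ E} {T : Geometry.SimplicialComplex ℝ F}
    (hST : Refines S (pullBackCells π P T)) (hπ : ∀ x ∈ Λ, π x ∈ M)
    (hT : ∀ t ∈ T.facets, IsUnimodularSimplex M t) {s : Finset E} (hs : s ∈ S.faces)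
    (hsΛ : (s : Set E) ⊆ Λ) : s.image π ∈ T.faces := by
  obtain ⟨_, ⟨t, ht, rfl⟩, hsC⟩ := hST s hs
  refine T.down_closed ht.1 (Finset.image_subset_iff.2 fun a ha => ?_)
    ((S.nonempty_of_mem_faces hs).image _)
  exact (hT t ht).mem_of_mem_convexHull (hπ a (hsΛ ha)) (hsC (subset_convexHull ℝ _ ha)).2

theorem exists_linearOrder_monotone {α γ : Type*} [LinearOrder γ] (f : α → γ) :
    ∃ _ : LinearOrder α, Monotone f := by
  classical
  let _ : LinearOrder α := linearOrderOfSTO WellOrderingRel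
  let toLexPair (a : α) : γ ×ₗ α := toLex (f a, a)
  have injective : Function.Injective toLexPair := fun a b h =>
    (Prod.ext_iff.1 (toLex.injective h)).2
  exact ⟨LinearOrder.lift' toLexPair injective, fun a b h => Prod.Lex.monotone_fst _ _ h⟩

theorem mainTheorem9_general {E E' F : Type*} [AddCommGroup E] [Module ℝ E] [AddCommGroup E']
    [Module ℝ E'] [AddCommGroup F] [Module ℝ F] {Λ : AddSubgroup E} {Λ' : AddSubgroup E'}
    {M : AddSubgroup F} {P : Set E} {P' : Set E'} (hP : Convex ℝ P) (hP' : Convex ℝ P')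
    {π : E →ᵃ[ℝ] F} {π' : E' →ᵃ[ℝ] F} (hπ : ∀ x ∈ Λ, π x ∈ M) (hπ' : ∀ x ∈ Λ', π' x ∈ M)
    {T : Geometry.SimplicialComplex ℝ F} {S : Geometry.SimplicialComplex ℝ E}
    {S' : Geometry.SimplicialComplex ℝ E'} (hT : ∀ t ∈ T.facets, IsUnimodularSimplex M t)
    (hS : IsUnimodularTriangulation Λ S P) (hS' : IsUnimodularTriangulation Λ' S' P')
    (hST : Refines S (pullBackCells π P T)) (hST' : Refines S' (pullBackCells π' P' T)) :
    IsLatticePolytope (Λ.prod Λ') (fiberProduct π π' P P') ∧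
    ∃ U : Geometry.SimplicialComplex ℝ (E × E'),
      IsUnimodularTriangulation (Λ.prod Λ') U (fiberProduct π π' P P') ∧
      (IsRegularTriangulation Λ S → IsRegularTriangulation Λ' S' →
        IsRegularTriangulation (Λ.prod Λ') U) ∧
      ∀ N : Finset (E × E'), IsMinimalNonface (Λ.prod Λ') U N →
        N.card = 2 ∨ (∃ M : Finset E, IsMinimalNonface Λ S M ∧ M.card = N.card) ∨
          ∃ M' : Finset E', IsMinimalNonface Λ' S' M' ∧ M'.card = N.card := by
  obtain ⟨_, -⟩ := exists_linearOrder_monotone fun _ : F => ()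
  obtain ⟨_, monotone_π⟩ := exists_linearOrder_monotone π
  obtain ⟨_, monotone_π'⟩ := exists_linearOrder_monotone π'
  have hU : IsUnimodularTriangulation (Λ.prod Λ') (staircaseComplex π π' S S')
      (fiberProduct π π' P P') :=
    isUnimodularTriangulation_staircaseComplex hS hS' monotone_π monotone_π'
      (fun _ hs => hST.image_mem_faces hπ hT hs (hS.isUnimodularSimplex hs).2.1)
      (fun _ hs => hST'.image_mem_faces hπ' hT hs (hS'.isUnimodularSimplex hs).2.1)
  exact ⟨hU.isLatticePolytope (convex_fiberProduct π π' hP hP'), staircaseComplex π π' S S', hU,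
    isRegularTriangulation_staircaseComplex hS hS' hP hP' hU,
    fun _ hN => hN.card_eq_two_or_of_staircaseComplex⟩

theorem mainTheorem9 {d d' e : ℕ}
    (P : Set (Fin d → ℝ)) (P' : Set (Fin d' → ℝ)) (Q : Set (Fin e → ℝ))
    (hP : IsLatticePolytope (intLattice d) P)
    (hP' : IsLatticePolytope (intLattice d') P')
    (hQ : IsLatticePolytope (intLattice e) Q)
    (π : (Fin d → ℝ) →ᵃ[ℝ] (Fin e → ℝ)) (π' : (Fin d' → ℝ) →ᵃ[ℝ] (Fin e → ℝ))
    (hπ : IsLatticeProjection (intLattice d) (intLattice e) π P Q)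
    (hπ' : IsLatticeProjection (intLattice d') (intLattice e) π' P' Q)
    (T : Geometry.SimplicialComplex ℝ (Fin e → ℝ))
    (S : Geometry.SimplicialComplex ℝ (Fin d → ℝ))
    (S' : Geometry.SimplicialComplex ℝ (Fin d' → ℝ))
    (hT : IsUnimodularTriangulation (intLattice e) T Q)
    (hS : IsUnimodularTriangulation (intLattice d) S P)
    (hS' : IsUnimodularTriangulation (intLattice d') S' P')
    (hST : Refines S (pullBackCells π P T))
    (hST' : Refines S' (pullBackCells π' P' T)) :
    IsLatticePolytope ((intLattice d).prod (intLattice d')) (fiberProduct π π' P P') ∧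
    ∃ U : Geometry.SimplicialComplex ℝ ((Fin d → ℝ) × (Fin d' → ℝ)),
      IsUnimodularTriangulation ((intLattice d).prod (intLattice d')) U
        (fiberProduct π π' P P') ∧
      (IsRegularTriangulation (intLattice d) S → IsRegularTriangulation (intLattice d') S' →
        IsRegularTriangulation ((intLattice d).prod (intLattice d')) U) ∧
      ∀ N : Finset ((Fin d → ℝ) × (Fin d' → ℝ)),
        IsMinimalNonface ((intLattice d).prod (intLattice d')) U N →
          N.card = 2 ∨
          (∃ M : Finset (Fin d → ℝ), IsMinimalNonface (intLattice d) S M ∧ M.card = N.card) ∨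
          (∃ M' : Finset (Fin d' → ℝ),
            IsMinimalNonface (intLattice d') S' M' ∧ M'.card = N.card) := by
  exact mainTheorem9_general hP.convex hP'.convex hπ.1 hπ'.1 hT.2.2 hS hS' hST hST'
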